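/- Let $\mathcal G$ be a causal diagram on a finite vertex set $\mathbf V$, i.e. an acyclic graph with directed edges $\to$ and bidirected edges $\leftrightarrow$, and let $Y\in\mathbf V$ be the reward variable. Sets of ancestors $\mathtt{An}$ and descendants $\mathtt{De}$ include the given set; $\mathtt{Pa}(\mathbf S)$ is the set of parents of members of $\mathbf S$; $\mathcal G_{\overline{\mathbf X}}$ is $\mathcal G$ without the edges that have an arrowhead at a vertex of $\mathbf X$; $\mathcal G[\mathbf S]$ is the induced subgraph. *Possibly-optimal intervention sets.* Consider structural causal models whose endogenous variables $\mathbf V$ have finite domains, with $Y$ real-valued and with mutually independent exogenous variables, and whose causal diagram is $\mathcal G$ ($A\to B$ iff $A$ is an argument of the function of $B$; $A\leftrightarrow B$ iff $A\ne B$ share an exogenous variable). Two sets $\mathbf R,\mathbf W\subseteq\mathbf V\setminus\{Y\}$ are *equivalent* if in every such model every joint assignment $\mathbf v$ of values to $\mathbf V$ satisfies $\mathbb E_{\mathbf v[\mathbf R]}Y=\mathbb E_{\mathbf v[\mathbf W]}Y$, where $\mathbb E_{\mathbf v[\mathbf R]}$ is the expectation under the intervention $do(\mathbf R=\mathbf v[\mathbf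 R])$. A set $\mathbf R\subseteq\mathtt{An}(Y)_{\mathcal G}\setminus\{Y\}$ is a *POIS* with respect to $\langle\mathcal G,Y\rangle$ if there is such a model in which $\max_{\mathbf r}\mathbb E_{\mathbf r}Y>\max_{\mathbf w}\mathbb E_{\mathbf w}Y$ for every $\mathbf W\subseteq\mathbf V\setminus\{Y\}$ that is not equivalent to $\mathbf R$. *Algorithm.* For a diagram $\mathcal H$ containing $Y$, $\mathsf{MUCT}(\mathcal H,Y)$ is the smallest vertex set of $\mathcal H'=\mathcal H[\mathtt{An}(Y)_{\mathcal H}]$ that contains $Y$ and is closed under descendants and under bidirected connection in $\mathcal H'$; with $\mathbf T=\mathsf{MUCT}(\mathcal H,Y)$, $\mathsf{IB}(\mathcal H,Y)=\mathtt{Pa}(\mathbf T)_{\mathcal H}\setminus\mathbf T$. Write $\mathcal F(\mathbf X,\mathbf T)=\{\mathbf R:\mathbf X\subseteq\mathbf R\subseteq\mathtt{An}(\mathbf T)_{\mathcal G}\setminus\mathbf T\}$, where $\mathcal G$ is always the input diagram. - $\mathsf{POISs}(\mathcal G,Y)$: put $\mathbf T=\mathsf{MUCT}(\mathcal G,Y)$,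 $\mathbf X=\mathsf{IB}(\mathcal G,Y)$, $\mathcal Q=\mathcal G_{\overline{\mathbf X}}[\mathbf T\cup\mathbf X]$; let $\pi$ be the reverse of a topological sort of $\mathcal Q$, with $Y$ removed; return $\mathcal F(\mathbf X,\mathbf T)\cup\mathsf{subPOISs}(\mathcal Q,Y,\pi,\emptyset)$. - $\mathsf{subPOISs}(\mathcal H,Y,\pi,\mathbf O)$: start from $\mathbf P=\emptyset$. For $i=1,\dots,|\pi|$ put $\mathbf T=\mathsf{MUCT}(\mathcal H_{\overline{\pi[i]}},Y)$, $\mathbf X=\mathsf{IB}(\mathcal H_{\overline{\pi[i]}},Y)$, $\pi'=\pi[i+1:]$, $\mathbf O'=\mathbf O\cup\pi[1:i-1]$; if $\mathbf X\cap\mathbf O'=\emptyset$, add to $\mathbf P$ the family $\mathcal F(\mathbf X,\mathbf T)$ and, if $\pi'\neq\emptyset$, also $\mathsf{subPOISs}(\mathcal H_{\overline{\mathbf X}}[\mathbf T\cup\mathbf X],Y,\pi',\mathbf O')$. After the loop return $\mathbf P$. **Proposition.** $\mathcal Q$ has a topological sort, and whichever topological sort of $\mathcal Q$ is used, $\mathsf{POISs}(\mathcal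 G,Y)$ returns all, and only, the POISs with respect to $\langle\mathcal G,Y\rangle$: for every $\mathbf R\subseteq\mathbf V$, $\mathbf R\in\mathsf{POISs}(\mathcal G,Y)$ if and only if $\mathbf R$ is a POIS with respect to $\langle\mathcal G,Y\rangle$. -/

import Mathlib

open MeasureTheory

universe u

/-- A causal diagram: an acyclic directed mixed graph on a finite vertex set `verts`, with
directed edges `dir a b` (that is, `a → b`) and bidirected edges `bi a b` (that is, `a ↔ b`). -/
structure CausalDiagram (V : Type u) where
  verts : Finset V
  dir : V → V → Prop
  bi : V → V → Prop
  dir_mem : ∀ a b, dir a b → a ∈ verts ∧ b ∈ verts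
  bi_mem : ∀ a b, bi a b → a ∈ verts ∧ b ∈ verts
  acyclic : ∀ a, ¬ Relation.TransGen dir a a
  bi_symm : ∀ a b, bi a b → bi b a
  bi_irrefl : ∀ a, ¬ bi a a

namespace CausalDiagram

variable {V : Type u} [Fintype V] [DecidableEq V]

/-- `G_{\overline X}`: delete every edge with an arrowhead at a vertex of `X`. -/
def cutIncoming (G : CausalDiagram V) (X : Finset V) : CausalDiagram V where
  verts := G.verts
  dir a b := G.dir a b ∧ b ∉ X
  bi a b := G.bi a b ∧ a ∉ X ∧ b ∉ X
  dir_mem a b h := G.dir_mem a b h.1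
  bi_mem a b h := G.bi_mem a b h.1
  acyclic a h := G.acyclic a (Relation.TransGen.mono (fun _ _ h => h.1) a a h)
  bi_symm a b h := ⟨G.bi_symm a b h.1, h.2.2, h.2.1⟩
  bi_irrefl a h := G.bi_irrefl a h.1

/-- `G[S]`: the subgraph induced by `S`. -/
def induce (G : CausalDiagram V) (S : Finset V) : CausalDiagram V where
  verts := G.verts ∩ S
  dir a b := G.dir a b ∧ a ∈ S ∧ b ∈ S
  bi a b := G.bi a b ∧ a ∈ S ∧ b ∈ S
  dir_mem a b h := by
    have := G.dir_mem a b h.1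
    simp [this, h.2]
  bi_mem a b h := by
    have := G.bi_mem a b h.1
    simp [this, h.2]
  acyclic a h := G.acyclic a (Relation.TransGen.mono (fun _ _ h => h.1) a a h)
  bi_symm a b h := ⟨G.bi_symm a b h.1, h.2.2, h.2.1⟩
  bi_irrefl a h := G.bi_irrefl a h.1

open Classical in
/-- Parents of a member of `S`. -/
noncomputable def parents (G : CausalDiagram V) (S : Finset V) : Finset V :=
  G.verts.filter fun v => ∃ s ∈ S, G.dir v s

open Classical in
/-- Ancestors of `S`, the vertices of `S` included. -/
noncomputable def ancestors (G : CausalDiagram V) (S : Finset V) : Finset V :=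
  G.verts.filter fun v => ∃ s ∈ S, Relation.ReflTransGen G.dir v s

open Classical in
/-- Descendants of `S`, the vertices of `S` included. -/
noncomputable def descendants (G : CausalDiagram V) (S : Finset V) : Finset V :=
  G.verts.filter fun v => ∃ s ∈ S, Relation.ReflTransGen G.dir s v

open Classical in
/-- The union of the c-components (connected components for the bidirected edges) that
meet `S`. -/
noncomputable def cComponents (G : CausalDiagram V) (S : Finset V) : Finset V :=
  G.verts.filter fun v => ∃ s ∈ S, Relation.ReflTransGen G.bi s v

/-- `T` is a UC-territory on `G` with respect to `Y`: with `H = G[An(Y)]`, it is a set of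
vertices of `H` that contains `Y` and is closed under descendants and c-components in `H`. -/
def IsUCTerritory (G : CausalDiagram V) (Y : V) (T : Finset V) : Prop :=
  T ⊆ (G.induce (G.ancestors {Y})).verts ∧ Y ∈ T ∧
    (G.induce (G.ancestors {Y})).descendants T = T ∧
    (G.induce (G.ancestors {Y})).cComponents T = T

open Classical in
/-- The minimal UC-territory, as the intersection of all UC-territories; see
`muct_isUCTerritory` and `eq_muct_iff_minimal`. -/
noncomputable def muct (G : CausalDiagram V) (Y : V) : Finset V :=
  G.verts.filter fun v => ∀ T, G.IsUCTerritory Y T → v ∈ T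

/-- The interventional border `Pa(T) \ T` of the minimal UC-territory `T`. -/
noncomputable def interventionalBorder (G : CausalDiagram V) (Y : V) : Finset V :=
  G.parents (G.muct Y) \ G.muct Y

lemma muct_subset {G : CausalDiagram V} {Y : V} {T : Finset V} (hT : G.IsUCTerritory Y T) :
    G.muct Y ⊆ T := by
  intro v hv
  simp only [muct, Finset.mem_filter] at hv
  exact hv.2 T hT

lemma muct_isUCTerritory (G : CausalDiagram V) {Y : V} (hY : Y ∈ G.verts) :
    G.IsUCTerritory Y (G.muct Y) := by
  set H := G.induce (G.ancestors {Y}) with hH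
  have hYH : Y ∈ H.verts := by
    simp only [hH, induce, ancestors, Finset.mem_inter, Finset.mem_filter]
    exact ⟨hY, hY, Y, by simp, Relation.ReflTransGen.refl⟩
  have hHG : H.verts ⊆ G.verts := Finset.inter_subset_left
  have hfull : G.IsUCTerritory Y H.verts := by
    refine ⟨subset_rfl, hYH, ?_, ?_⟩
    · ext v
      simp only [descendants, Finset.mem_filter]
      exact ⟨fun h => h.1, fun h => ⟨h, v, h, Relation.ReflTransGen.refl⟩⟩
    · ext v
      simp only [cComponents, Finset.mem_filter]
      exact ⟨fun h => h.1, fun h => ⟨h, v, h, Relation.ReflTransGen.refl⟩⟩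
  have hsub : G.muct Y ⊆ H.verts := muct_subset hfull
  refine ⟨hsub, ?_, ?_, ?_⟩
  · simp only [muct, Finset.mem_filter]
    exact ⟨hY, fun T hT => hT.2.1⟩
  · ext v
    constructor
    · intro hv
      simp only [descendants, Finset.mem_filter] at hv
      obtain ⟨hvH, s, hs, hsv⟩ := hv
      simp only [muct, Finset.mem_filter]
      refine ⟨hHG hvH, fun T hT => ?_⟩
      rw [← hT.2.2.1]
      simp only [descendants, Finset.mem_filter]
      exact ⟨hvH, s, muct_subset hT hs, hsv⟩
    · intro hv
      simp only [descendants, Finset.mem_filter]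
      exact ⟨hsub hv, v, hv, Relation.ReflTransGen.refl⟩
  · ext v
    constructor
    · intro hv
      simp only [cComponents, Finset.mem_filter] at hv
      obtain ⟨hvH, s, hs, hsv⟩ := hv
      simp only [muct, Finset.mem_filter]
      refine ⟨hHG hvH, fun T hT => ?_⟩
      rw [← hT.2.2.2]
      simp only [cComponents, Finset.mem_filter]
      exact ⟨hvH, s, muct_subset hT hs, hsv⟩
    · intro hv
      simp only [cComponents, Finset.mem_filter]
      exact ⟨hsub hv, v, hv, Relation.ReflTransGen.refl⟩

/-- `muct` is the unique minimal UC-territory. -/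
lemma eq_muct_iff_minimal (G : CausalDiagram V) {Y : V} (hY : Y ∈ G.verts) (T : Finset V) :
    T = G.muct Y ↔ Minimal (G.IsUCTerritory Y) T := by
  constructor
  · rintro rfl
    exact ⟨G.muct_isUCTerritory hY, fun S hS _ => muct_subset hS⟩
  · intro h
    exact le_antisymm (h.2 (G.muct_isUCTerritory hY) (muct_subset h.1)) (muct_subset h.1)

/-- `l` lists the vertices of `G`, each once, parents before their children. -/
def IsTopologicalSort (G : CausalDiagram V) (l : List V) : Prop :=
  l.Nodup ∧ (∀ v, v ∈ l ↔ v ∈ G.verts) ∧ l.Pairwise fun a b => ¬ G.dir b a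

/-- The family `{R | X ⊆ R ⊆ An(T)_G \ T}`. -/
noncomputable def between (G : CausalDiagram V) (X T : Finset V) : Finset (Finset V) :=
  Finset.univ.filter fun R => X ⊆ R ∧ R ⊆ G.ancestors T \ T

/-- The recursive procedure, run on a current diagram `H`, a list `π` and a set `O`, for the input
diagram `G`. The `for` loop over the entries `π[i]` of `π` is unrolled along the list: the first
entry `p` is treated with `π' = π[i+1:]` and `O' = O`, and the remaining iterations of the same loop
are those over the tail of `π` with `p` added to `O` (so that `O' = O ∪ π[1:i-1]` at the `i`-th
iteration of the loop). -/
noncomputable def subPOISs (G : CausalDiagram V) (Y : V) :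
    CausalDiagram V → List V → Finset V → Finset (Finset V)
  | _, [], _ => ∅
  | H, p :: π', O =>
    let T := (H.cutIncoming {p}).muct Y
    let X := (H.cutIncoming {p}).interventionalBorder Y
    (if X ∩ O = ∅ then
        G.between X T ∪
          (if π' ≠ [] then subPOISs G Y ((H.cutIncoming X).induce (T ∪ X)) π' O else ∅)
      else ∅) ∪
    subPOISs G Y H π' (O ∪ {p})

/-- The diagram `Q = G_{\overline X}[T ∪ X]` with `T = MUCT(G, Y)` and `X = IB(G, Y)`, on which the
enumeration starts. -/
noncomputable def startDiagram (G : CausalDiagram V) (Y : V) : CausalDiagram V :=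
  (G.cutIncoming (G.interventionalBorder Y)).induce (G.muct Y ∪ G.interventionalBorder Y)

/-- The enumeration algorithm, run with the topological sort `l` of `Q`. The reward variable, which
cannot be intervened on, is left out of the list of candidate vertices. -/
noncomputable def POISs (G : CausalDiagram V) (Y : V) (l : List V) : Finset (Finset V) :=
  G.between (G.interventionalBorder Y) (G.muct Y) ∪
    G.subPOISs Y (G.startDiagram Y) (l.reverse.filter (· ≠ Y)) ∅

end CausalDiagram

/-- A (recursive) structural causal model with endogenous variables `V`, each with a finite discrete
domain, and a real-valued reward variable `Y`. The exogenous variables are mutually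
independent, of arbitrary law; `scope j` is the set of endogenous variables whose structural function
takes the exogenous variable `j` as an argument. -/
structure SCM (V : Type u) (Y : V) where
  Dom : V → Type
  [domFintype : ∀ v, Fintype (Dom v)]
  [domNonempty : ∀ v, Nonempty (Dom v)]
  /-- the real number that a value of `Y` stands for -/
  value : Dom Y ↪ ℝ
  J : Type u
  [exoFintype : Fintype J]
  U : J → Type
  [exoMeasurableSpace : ∀ j, MeasurableSpace (U j)]
  P : ∀ j, Measure (U j)
  [exoProb : ∀ j, IsProbabilityMeasure (P j)]
  pa : V → Finset V
  wf : WellFounded fun a b => a ∈ pa b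
  scope : J → Finset V
  f : ∀ v, (∀ p : {p // p ∈ pa v}, Dom p) → (∀ j : {j // v ∈ scope j}, U j) → Dom v
  f_meas : ∀ v c d, MeasurableSet {e | f v c e = d}

namespace SCM

variable {V : Type u} [DecidableEq V] {Y : V}

attribute [instance] SCM.domFintype SCM.domNonempty SCM.exoFintype SCM.exoMeasurableSpace
  SCM.exoProb

/-- The causal diagram of the model is `G`: `a → b` if and only if `a` is an argument of the function
of `b`, and `a ↔ b` if and only if `a ≠ b` share an exogenous variable. -/
def Conforms (M : SCM V Y) (G : CausalDiagram V) : Prop :=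
  (∀ a b, G.dir a b ↔ a ∈ M.pa b) ∧
    ∀ a b, G.bi a b ↔ a ≠ b ∧ ∃ j, a ∈ M.scope j ∧ b ∈ M.scope j

/-- The values of the endogenous variables under the intervention `do(X = x[X])` when the exogenous
variables take the values `e`. -/
noncomputable def solve (M : SCM V Y) (X : Finset V) (x : ∀ v, M.Dom v) (e : ∀ j, M.U j) :
    ∀ v, M.Dom v :=
  M.wf.fix fun v ih =>
    if v ∈ X then x v else M.f v (fun p => ih p.1 p.2) (fun j => e j.1)

/-- The expected reward of `do(X = x[X])`; only the coordinates of `x` in `X` matter. -/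
noncomputable def expectedReward (M : SCM V Y) (X : Finset V) (x : ∀ v, M.Dom v) : ℝ :=
  ∫ e, M.value (M.solve X x e Y) ∂(Measure.pi M.P)

/-- The largest expected reward of an intervention on `X` (a maximum over finitely many values). -/
noncomputable def bestReward (M : SCM V Y) (X : Finset V) : ℝ :=
  ⨆ x : ∀ v, M.Dom v, M.expectedReward X x

lemma solve_eq (M : SCM V Y) (X : Finset V) (x : ∀ v, M.Dom v) (e : ∀ j, M.U j) (v : V) :
    M.solve X x e v =
      if v ∈ X then x v else M.f v (fun p => M.solve X x e p.1) (fun j => e j.1) := by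
  rw [solve, WellFounded.fix_eq]

lemma measurableSet_solve (M : SCM V Y) (X : Finset V) (x : ∀ v, M.Dom v) (v : V) :
    ∀ d, MeasurableSet {e | M.solve X x e v = d} := by
  classical
  induction v using M.wf.induction with
  | _ v ih =>
    intro d
    by_cases hv : v ∈ X
    · simp [solve_eq, hv]
    · have : {e | M.solve X x e v = d} =
          ⋃ c : ∀ p : {p // p ∈ M.pa v}, M.Dom p,
            (⋂ p : {p // p ∈ M.pa v}, {e | M.solve X x e p.1 = c p}) ∩
              (fun e (j : {j // v ∈ M.scope j}) => e j.1) ⁻¹' {e | M.f v c e = d} := by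
        ext e
        rw [Set.mem_ofPred_eq, solve_eq, if_neg hv]
        simp only [Set.mem_iUnion, Set.mem_inter_iff, Set.mem_iInter, Set.mem_ofPred_eq,
          Set.mem_preimage]
        constructor
        · intro h
          exact ⟨fun p => M.solve X x e p.1, fun _ => rfl, h⟩
        · rintro ⟨c, hc, h⟩
          have hc' : c = fun p : {p // p ∈ M.pa v} => M.solve X x e p.1 :=
            funext fun p => (hc p).symm
          rwa [hc'] at h
      rw [this]
      refine MeasurableSet.iUnion fun c => (MeasurableSet.iInter fun (p : {p // p ∈ M.pa v}) => ih p.1 p.2 _).inter ?_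
      exact (measurable_pi_lambda _ fun j => measurable_pi_apply j.1) (M.f_meas v c d)

/-- The expected reward is a genuine expectation. -/
lemma integrable_reward (M : SCM V Y) (X : Finset V) (x : ∀ v, M.Dom v) :
    Integrable (fun e => M.value (M.solve X x e Y)) (Measure.pi M.P) := by
  let _ : MeasurableSpace (M.Dom Y) := ⊤
  have hm : Measurable fun e => M.solve X x e Y :=
    measurable_to_countable' fun d => M.measurableSet_solve X x Y d
  obtain ⟨C, hC⟩ := (Set.finite_range fun d : M.Dom Y => ‖M.value d‖).bddAbove
  refine Integrable.of_bound
    ((measurable_from_top (f := M.value)).comp hm).aestronglyMeasurable C ?_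
  exact Filter.Eventually.of_forall fun e => hC ⟨M.solve X x e Y, rfl⟩

end SCM

section Bandit

variable {V : Type u} [Fintype V] [DecidableEq V]

/-- `R` and `W` are equivalent in terms of expected reward: in every model that conforms to `G`, every
joint assignment `x` gives `E_{x[R]} Y = E_{x[W]} Y`. -/
def RewardEquivalent (G : CausalDiagram V) (Y : V) (R W : Finset V) : Prop :=
  ∀ M : SCM V Y, M.Conforms G → ∀ x, M.expectedReward R x = M.expectedReward W x

/-- `R` is a possibly-optimal intervention set: a set of proper ancestors of `Y` such that, in some
model that conforms to `G`, intervening on `R` is strictly better at best than intervening on any set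
`W ⊆ V \ {Y}` that is not equivalent to `R`. -/
def IsPOIS (G : CausalDiagram V) (Y : V) (R : Finset V) : Prop :=
  R ⊆ G.ancestors {Y} \ {Y} ∧
    ∃ M : SCM V Y, M.Conforms G ∧
      ∀ W : Finset V, Y ∉ W → ¬ RewardEquivalent G Y R W → M.bestReward W < M.bestReward R

end Bandit

/-!
Call `T` a territory if it is the minimal UC-territory of the subgraph `G[T]` that it induces. Both
sides of the equivalence turn out to be the condition that `Pa(T) \ T ⊆ R ⊆ An(T) \ T` for some
territory `T`.

For a POIS `R`, let `T = MUCT(G_{\overline R}, Y)`, a territory, and `X = Pa(T) \ T`. The exogenous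
variables read inside `T` do not influence the values on `X` under an intervention on `R`.
Therefore the other exogenous variables can be frozen at values that do not lower the expected
reward, and setting `X` to the values that result is at least as good as the intervention on `R`.
Hence `R` is equivalent to `X`, and this forces `X ⊆ R`.

Conversely, given a territory `T`, let every bidirected edge carry a fair coin that both of its ends
read, let the vertices of `T` pass on what they know of the coins along directed edges, and let the
reward be high if `Y` hears of no contradiction. Intervening on all of `X` and on no vertex of `T`
keeps the messages truthful. An intervention that meets `T` has to guess the value of a coin which
`Y` also hears of along an untouched path, and one that misses a vertex of `X` lets noise in.

As for the enumeration, every diagram that it meets retains exactly those edges of `G` whose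
arrowheads all lie in a certain set of vertices, so that the families it adds are the
`F(Pa(T) \ T, T)` of territories `T`. A given territory `S` is reached by following, in each call, the
iteration of the first vertex of the list that lies in `Pa(S) \ S`. No vertex passed over on the way
can lie in the border of an intermediate territory, because the list runs against a topological
order.
-/

lemma not_injOn_fst_of_mem_not {α : Type*} {s : Set (α × Bool)} {a : α} {b : Bool} (h : (a, b) ∈ s)
    (h' : (a, !b) ∈ s) : ¬ Set.InjOn Prod.fst s := fun hinj =>
  Bool.not_ne_self b (congrArg Prod.snd (hinj h h' rfl)).symm

lemma exists_embedding_real_lt {α : Type*} [Countable α] {a b : α} (h : a ≠ b) :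
    ∃ φ : α ↪ ℝ, φ a < φ b := by
  obtain ⟨φ, hφ⟩ := exists_injective_nat α
  rcases (hφ.ne h).lt_or_gt with hlt | hgt
  · exact ⟨⟨fun x => φ x, Nat.cast_injective.comp hφ⟩, Nat.cast_lt.2 hlt⟩
  · exact ⟨⟨fun x => -φ x, neg_injective.comp (Nat.cast_injective.comp hφ)⟩,
      neg_lt_neg (Nat.cast_lt.2 hgt)⟩

lemma integral_lt_of_forall_le_of_exists_lt {Ω : Type*} [Finite Ω] [MeasurableSpace Ω]
    [MeasurableSingletonClass Ω] {μ : Measure Ω} [IsProbabilityMeasure μ] {f : Ω → ℝ} {c : ℝ}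
    (hle : ∀ ω, f ω ≤ c) {ω₀ : Ω} (hlt : f ω₀ < c) (hμ : μ {ω₀} ≠ 0) : ∫ ω, f ω ∂μ < c := by
  have hpos : 0 < ∫ ω, (c - f ω) ∂μ := by
    refine (integral_pos_iff_support_of_nonneg (fun ω => sub_nonneg.2 (hle ω)) .of_finite).2 ?_
    refine (pos_iff_ne_zero.2 hμ).trans_le (measure_mono ?_)
    exact Set.singleton_subset_iff.2 (sub_pos.2 hlt).ne'
  rw [integral_sub .of_finite .of_finite, integral_const, probReal_univ, one_smul] at hpos
  exact sub_pos.1 hpos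

section Piecewise

variable {ι : Type*} [Fintype ι] {α : ι → Type*} [∀ i, MeasurableSpace (α i)]
  (μ : ∀ i, Measure (α i)) [∀ i, IsProbabilityMeasure (μ i)] (s : Set ι) [∀ i, Decidable (i ∈ s)]

lemma measurePreserving_piecewise :
    MeasurePreserving (fun z : (∀ i, α i) × (∀ i, α i) => s.piecewise z.1 z.2)
      ((Measure.pi μ).prod (Measure.pi μ)) (Measure.pi μ) := by
  have hmeas : Measurable fun z : (∀ i, α i) × (∀ i, α i) => s.piecewise z.1 z.2 := by
    refine measurable_pi_lambda _ fun i => ?_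
    by_cases hi : i ∈ s
    · simp only [Set.piecewise, if_pos hi]
      exact (measurable_pi_apply i).comp measurable_fst
    · simp only [Set.piecewise, if_neg hi]
      exact (measurable_pi_apply i).comp measurable_snd
  refine ⟨hmeas, (Measure.pi_eq fun t ht => ?_).symm⟩
  have hpre : (fun z : (∀ i, α i) × (∀ i, α i) => s.piecewise z.1 z.2) ⁻¹' Set.univ.pi t =
      Set.univ.pi (fun i => if i ∈ s then t i else Set.univ) ×ˢ
        Set.univ.pi (fun i => if i ∈ s then Set.univ else t i) := by
    ext z
    simp only [Set.mem_preimage, Set.mem_prod, Set.mem_univ_pi, Set.piecewise, ← forall_and]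
    refine forall_congr' fun i => ?_
    split_ifs <;> simp
  rw [Measure.map_apply hmeas (MeasurableSet.univ_pi ht), hpre, Measure.prod_prod, Measure.pi_pi,
    Measure.pi_pi, ← Finset.prod_mul_distrib]
  refine Finset.prod_congr rfl fun i _ => ?_
  split_ifs <;> simp

lemma exists_integral_pi_le_integral_piecewise {f : (∀ i, α i) → ℝ}
    (hf : Integrable f (Measure.pi μ)) :
    ∃ a, ∫ e, f e ∂Measure.pi μ ≤ ∫ e, f (s.piecewise e a) ∂Measure.pi μ := by
  have hφ := measurePreserving_piecewise μ s
  have hfφ : Integrable (fun z : (∀ i, α i) × (∀ i, α i) => f (s.piecewise z.1 z.2))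
      ((Measure.pi μ).prod (Measure.pi μ)) := hφ.integrable_comp_of_integrable hf
  obtain ⟨a, ha⟩ := exists_integral_le hfφ.integral_prod_right
  refine ⟨a, le_of_eq_of_le ?_ ha⟩
  rw [← integral_prod_symm _ hfφ, ← integral_map hφ.aemeasurable
    (hφ.map_eq.symm ▸ hf.aestronglyMeasurable), hφ.map_eq]

end Piecewise

open Relation

namespace CausalDiagram

section Paths

variable {V : Type u} {G : CausalDiagram V} {Y v : V}

lemma mem_verts_of_reflTransGen (h : ReflTransGen G.dir v Y) (hY : Y ∈ G.verts) :
    v ∈ G.verts := by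
  rcases h.cases_head with rfl | ⟨w, hvw, -⟩
  exacts [hY, (G.dir_mem _ _ hvw).1]

lemma mem_ancestors_singleton (hY : Y ∈ G.verts) :
    v ∈ G.ancestors {Y} ↔ ReflTransGen G.dir v Y := by
  simp only [ancestors, Finset.mem_filter, Finset.mem_singleton, exists_eq_left]
  exact and_iff_right_of_imp fun h => mem_verts_of_reflTransGen h hY

lemma wellFounded_dir [Finite V] (G : CausalDiagram V) : WellFounded G.dir :=
  have : Std.Irrefl (TransGen G.dir) := ⟨G.acyclic⟩
  Subrelation.wf TransGen.single (Finite.wellFounded_of_trans_of_irrefl (TransGen G.dir))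

lemma ne_of_dir_of_reflTransGen {p : V} (hpv : G.dir p v) (hv : ReflTransGen G.dir v Y) :
    p ≠ Y := by
  rintro rfl
  exact G.acyclic p (TransGen.head' hpv hv)

variable [DecidableEq V] {S : Finset V} {w : V}

lemma reflTransGen_of_induce (h : ReflTransGen (G.induce S).dir v w) : ReflTransGen G.dir v w :=
  ReflTransGen.mono (fun _ _ hab => hab.1) _ _ h

end Paths

section Border

variable {V : Type u} [DecidableEq V] {G : CausalDiagram V} {S T : Finset V} {v : V}

/-- The border `Pa(T) \ T` of a set of vertices `T`, of which the interventional border is the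
special case of the minimal UC-territory. -/
noncomputable def border (G : CausalDiagram V) (T : Finset V) : Finset V := G.parents T \ T

lemma mem_border : v ∈ G.border T ↔ v ∉ T ∧ ∃ t ∈ T, G.dir v t := by
  simp only [border, parents, Finset.mem_sdiff, Finset.mem_filter]
  exact ⟨fun h => ⟨h.2, h.1.2⟩, fun ⟨h, t, ht, hd⟩ => ⟨⟨(G.dir_mem _ _ hd).1, t, ht, hd⟩, h⟩⟩

lemma mem_or_mem_border {t : V} (hvt : G.dir v t) (ht : t ∈ T) : v ∈ T ∨ v ∈ G.border T :=
  or_iff_not_imp_left.2 fun hv => mem_border.2 ⟨hv, t, ht, hvt⟩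

lemma disjoint_border : Disjoint (G.border T) T :=
  Finset.sdiff_disjoint

lemma border_induce_subset : (G.induce S).border T ⊆ G.border T ∩ S := by
  intro v hv
  obtain ⟨hvT, t, ht, hvt⟩ := mem_border.1 hv
  exact Finset.mem_inter.2 ⟨mem_border.2 ⟨hvT, t, ht, hvt.1⟩, hvt.2.1⟩

lemma exists_mem_border_of_reflTransGen {t : V} (h : ReflTransGen G.dir v t) (ht : t ∈ T)
    (hv : v ∉ T) : ∃ x ∈ G.border T, ReflTransGen G.dir v x := by
  induction h using ReflTransGen.head_induction_on with
  | refl => exact absurd ht hv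
  | @head a c hac _ ih =>
    by_cases hc : c ∈ T
    · exact ⟨a, mem_border.2 ⟨hv, c, hc, hac⟩, ReflTransGen.refl⟩
    · obtain ⟨x, hx, hcx⟩ := ih hc
      exact ⟨x, hx, hcx.head hac⟩

end Border

section Muct

lemma filter_reflTransGen_eq_self_iff {α : Type*} {r : α → α → Prop} {S T : Finset α}
    [DecidablePred fun v => ∃ s ∈ T, ReflTransGen r s v] (hTS : T ⊆ S)
    (hr : ∀ a b, r a b → b ∈ S) :
    (S.filter fun v => ∃ s ∈ T, ReflTransGen r s v) = T ↔ ∀ v ∈ T, ∀ w, r v w → w ∈ T := by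
  constructor
  · intro h v hv w hvw
    exact h ▸ Finset.mem_filter.2 ⟨hr v w hvw, v, hv, ReflTransGen.single hvw⟩
  · refine fun h => Finset.Subset.antisymm (fun w hw => ?_) fun w hw =>
      Finset.mem_filter.2 ⟨hTS hw, w, hw, ReflTransGen.refl⟩
    obtain ⟨-, v, hv, hvw⟩ := Finset.mem_filter.1 hw
    clear hw
    induction hvw with
    | refl => exact hv
    | tail _ hab ih => exact h _ ih _ hab

variable {V : Type u} [DecidableEq V] {G : CausalDiagram V} {Y : V}

lemma induce_ancestors_dir_iff (hY : Y ∈ G.verts) {a b : V} :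
    (G.induce (G.ancestors {Y})).dir a b ↔ G.dir a b ∧ ReflTransGen G.dir b Y := by
  simp only [induce, mem_ancestors_singleton hY]
  exact ⟨fun h => ⟨h.1, h.2.2⟩, fun h => ⟨h.1, h.2.head h.1, h.2⟩⟩

lemma isUCTerritory_iff (hY : Y ∈ G.verts) {T : Finset V} :
    G.IsUCTerritory Y T ↔ Y ∈ T ∧ (∀ v ∈ T, ReflTransGen G.dir v Y) ∧
      (∀ v ∈ T, ∀ w, G.dir v w → ReflTransGen G.dir w Y → w ∈ T) ∧
      ∀ v ∈ T, ∀ w, G.bi v w → ReflTransGen G.dir w Y → w ∈ T := by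
  classical
  have mem_verts (v : V) :
      v ∈ (G.induce (G.ancestors {Y})).verts ↔ ReflTransGen G.dir v Y := by
    simp only [induce, Finset.mem_inter, mem_ancestors_singleton hY, and_iff_right_iff_imp]
    exact fun h => mem_verts_of_reflTransGen h hY
  have subset_iff : T ⊆ (G.induce (G.ancestors {Y})).verts ↔ ∀ v ∈ T, ReflTransGen G.dir v Y :=
    forall₂_congr fun v _ => mem_verts v
  rw [IsUCTerritory, and_left_comm, subset_iff]
  refine and_congr_right fun _ => and_congr_right fun hT => ?_
  refine and_congr
    ((filter_reflTransGen_eq_self_iff (subset_iff.2 hT) fun a b h => (dir_mem _ a b h).2).trans ?_)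
    ((filter_reflTransGen_eq_self_iff (subset_iff.2 hT) fun a b h => (bi_mem _ a b h).2).trans ?_)
  · simp only [induce_ancestors_dir_iff hY, and_imp]
  · refine forall₃_congr fun v hv w => ?_
    simp only [induce, mem_ancestors_singleton hY, hT v hv, true_and, and_imp]

variable [Fintype V] {v w : V}

lemma muct_subset_verts : G.muct Y ⊆ G.verts := by
  classical
  exact Finset.filter_subset _ _

lemma mem_muct_self (hY : Y ∈ G.verts) : Y ∈ G.muct Y :=
  (G.muct_isUCTerritory hY).2.1

lemma reflTransGen_of_mem_muct (hY : Y ∈ G.verts) (hv : v ∈ G.muct Y) :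
    ReflTransGen G.dir v Y :=
  ((isUCTerritory_iff hY).1 (G.muct_isUCTerritory hY)).2.1 v hv

lemma mem_muct_of_dir (hY : Y ∈ G.verts) (hv : v ∈ G.muct Y) (hvw : G.dir v w)
    (hw : ReflTransGen G.dir w Y) : w ∈ G.muct Y :=
  ((isUCTerritory_iff hY).1 (G.muct_isUCTerritory hY)).2.2.1 v hv w hvw hw

lemma mem_muct_of_bi (hY : Y ∈ G.verts) (hv : v ∈ G.muct Y) (hvw : G.bi v w)
    (hw : ReflTransGen G.dir w Y) : w ∈ G.muct Y :=
  ((isUCTerritory_iff hY).1 (G.muct_isUCTerritory hY)).2.2.2 v hv w hvw hw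

lemma muct_induction (hY : Y ∈ G.verts) {P : V → Prop} (self : P Y)
    (dir : ∀ v ∈ G.muct Y, P v → ∀ w ∈ G.muct Y, G.dir v w → P w)
    (bi : ∀ v ∈ G.muct Y, P v → ∀ w ∈ G.muct Y, G.bi v w → P w) :
    ∀ v ∈ G.muct Y, P v := by
  classical
  have hP : G.IsUCTerritory Y ((G.muct Y).filter P) := by
    simp only [isUCTerritory_iff hY, Finset.mem_filter]
    refine ⟨⟨mem_muct_self hY, self⟩, fun v hv => reflTransGen_of_mem_muct hY hv.1,
      fun v hv w hvw hw => ?_, fun v hv w hvw hw => ?_⟩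
    · have hwT := mem_muct_of_dir hY hv.1 hvw hw
      exact ⟨hwT, dir v hv.1 hv.2 w hwT hvw⟩
    · have hwT := mem_muct_of_bi hY hv.1 hvw hw
      exact ⟨hwT, bi v hv.1 hv.2 w hwT hvw⟩
  exact fun v hv => (Finset.mem_filter.1 (muct_subset hP hv)).2

lemma muct_mono {K : CausalDiagram V} (hYK : Y ∈ K.verts) (hYG : Y ∈ G.verts)
    (dir : ∀ a b, K.dir a b → G.dir a b) (bi : ∀ a b, K.bi a b → G.bi a b) :
    K.muct Y ⊆ G.muct Y := by
  have path {v : V} (hv : v ∈ K.muct Y) : ReflTransGen G.dir v Y :=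
    ReflTransGen.mono dir _ _ (reflTransGen_of_mem_muct hYK hv)
  exact muct_induction hYK (mem_muct_self hYG)
    (fun v _ hv w hw hvw => mem_muct_of_dir hYG hv (dir v w hvw) (path hw))
    fun v _ hv w hw hvw => mem_muct_of_bi hYG hv (bi v w hvw) (path hw)

lemma reflTransGen_induce_muct (hY : Y ∈ G.verts) (hv : v ∈ G.muct Y) :
    ReflTransGen (G.induce (G.muct Y)).dir v Y := by
  have hvY := reflTransGen_of_mem_muct hY hv
  induction hvY using ReflTransGen.head_induction_on with
  | refl => exact ReflTransGen.refl
  | head hac hcY ih =>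
    have hc := mem_muct_of_dir hY hv hac hcY
    exact (ih hc).head ⟨hac, hv, hc⟩

lemma muct_induce_muct (hY : Y ∈ G.verts) : (G.induce (G.muct Y)).muct Y = G.muct Y := by
  have hYT : Y ∈ (G.induce (G.muct Y)).verts := Finset.mem_inter.2 ⟨hY, mem_muct_self hY⟩
  refine (muct_mono hYT hY (fun _ _ h => h.1) fun _ _ h => h.1).antisymm ?_
  exact muct_induction hY (mem_muct_self hYT)
    (fun v hvT hv w hwT hvw =>
      mem_muct_of_dir hYT hv ⟨hvw, hvT, hwT⟩ (reflTransGen_induce_muct hY hwT))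
    fun v hvT hv w hwT hvw =>
      mem_muct_of_bi hYT hv ⟨hvw, hvT, hwT⟩ (reflTransGen_induce_muct hY hwT)

end Muct

section Territory

variable {V : Type u} [Fintype V] [DecidableEq V] {G : CausalDiagram V} {Y : V} {S T : Finset V}

/-- `T` is the minimal UC-territory of the diagram `G[T]` that it induces. The possibly-optimal
intervention sets are classified by these sets. -/
structure IsTerritory (G : CausalDiagram V) (Y : V) (T : Finset V) : Prop where
  mem : Y ∈ T
  muct_induce : (G.induce T).muct Y = T

namespace IsTerritory

lemma mem_verts_induce (hT : G.IsTerritory Y T) : Y ∈ (G.induce T).verts :=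
  muct_subset_verts (hT.muct_induce.symm ▸ hT.mem : Y ∈ (G.induce T).muct Y)

lemma path {v : V} (hT : G.IsTerritory Y T) (hv : v ∈ T) :
    ReflTransGen (G.induce T).dir v Y :=
  reflTransGen_of_mem_muct hT.mem_verts_induce (hT.muct_induce.symm ▸ hv)

lemma induction (hT : G.IsTerritory Y T) {P : V → Prop} (self : P Y)
    (dir : ∀ v ∈ T, P v → ∀ w ∈ T, G.dir v w → P w)
    (bi : ∀ v ∈ T, P v → ∀ w ∈ T, G.bi v w → P w) : ∀ v ∈ T, P v := by
  have key := muct_induction hT.mem_verts_induce (P := P) self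
  rw [hT.muct_induce] at key
  exact key (fun v hvT hv w hwT hvw => dir v hvT hv w hwT hvw.1)
    fun v hvT hv w hwT hvw => bi v hvT hv w hwT hvw.1

lemma ancestors_eq (hT : G.IsTerritory Y T) : G.ancestors T = G.ancestors {Y} := by
  ext v
  simp only [ancestors, Finset.mem_filter, Finset.mem_singleton, exists_eq_left]
  refine and_congr_right fun _ => ⟨?_, fun hvY => ⟨Y, hT.mem, hvY⟩⟩
  rintro ⟨t, ht, hvt⟩
  exact hvt.trans (reflTransGen_of_induce (hT.path ht))

lemma subset_of_disjoint_border (hS : G.IsTerritory Y S) (hY : Y ∈ T)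
    (h : Disjoint (G.border T) S) : S ⊆ T := by
  intro v hv
  by_contra hvT
  obtain ⟨x, hx, -⟩ := exists_mem_border_of_reflTransGen (hS.path hv) hY hvT
  have hxS := Finset.mem_inter.1 (border_induce_subset hx)
  exact Finset.disjoint_left.1 h hxS.1 hxS.2

end IsTerritory

end Territory

section Cut

variable {V : Type u} {G H : CausalDiagram V} {Y : V} {A T : Finset V}

/-- The edges of `H` are those edges of `G` all of whose arrowheads lie in `A`: every diagram met by
the enumeration arises in this way from the input diagram. -/
structure IsCutTo (G : CausalDiagram V) (Y : V) (A : Finset V) (H : CausalDiagram V) : Prop where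
  mem : Y ∈ A
  mem_verts : Y ∈ H.verts
  verts_subset : H.verts ⊆ G.verts
  dir_iff : ∀ a b, H.dir a b ↔ G.dir a b ∧ b ∈ A
  bi_iff : ∀ a b, H.bi a b ↔ G.bi a b ∧ a ∈ A ∧ b ∈ A

lemma isCutTo_self [Fintype V] (hY : Y ∈ G.verts) : G.IsCutTo Y Finset.univ G where
  mem := Finset.mem_univ Y
  mem_verts := hY
  verts_subset := Finset.Subset.rfl
  dir_iff a b := by simp only [Finset.mem_univ, and_true]
  bi_iff a b := by simp only [Finset.mem_univ, and_true]

namespace IsCutTo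

variable [DecidableEq V]

lemma cutIncoming_singleton (h : G.IsCutTo Y A H) {p : V} (hp : p ≠ Y) :
    G.IsCutTo Y (A.erase p) (H.cutIncoming {p}) where
  mem := Finset.mem_erase.2 ⟨hp.symm, h.mem⟩
  mem_verts := h.mem_verts
  verts_subset := h.verts_subset
  dir_iff a b := by
    simp only [cutIncoming, h.dir_iff, Finset.mem_singleton, Finset.mem_erase]
    tauto
  bi_iff a b := by
    simp only [cutIncoming, h.bi_iff, Finset.mem_singleton, Finset.mem_erase]
    tauto

lemma induce_border (h : G.IsCutTo Y A H) (hY : Y ∈ T) (hTA : T ⊆ A) :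
    G.IsCutTo Y T ((H.cutIncoming (G.border T)).induce (T ∪ G.border T)) where
  mem := hY
  mem_verts := Finset.mem_inter.2 ⟨h.mem_verts, Finset.mem_union_left _ hY⟩
  verts_subset := Finset.inter_subset_left.trans h.verts_subset
  dir_iff a b := by
    have tail_mem (hab : G.dir a b) (hb : b ∈ T) : a ∈ T ∨ a ∈ G.border T :=
      mem_or_mem_border hab hb
    have notMem_border (hb : b ∈ T) : b ∉ G.border T := Finset.disjoint_right.1 disjoint_border hb
    have mem_A (hb : b ∈ T) : b ∈ A := hTA hb
    simp only [induce, cutIncoming, h.dir_iff, Finset.mem_union]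
    tauto
  bi_iff a b := by
    have notMem_border {v : V} (hv : v ∈ T) : v ∉ G.border T :=
      Finset.disjoint_right.1 disjoint_border hv
    simp only [induce, cutIncoming, h.bi_iff, Finset.mem_union]
    constructor
    · rintro ⟨⟨⟨hab, -⟩, ha, hb⟩, ha', hb'⟩
      exact ⟨hab, ha'.resolve_right ha, hb'.resolve_right hb⟩
    · rintro ⟨hab, ha, hb⟩
      exact ⟨⟨⟨hab, hTA ha, hTA hb⟩, notMem_border ha, notMem_border hb⟩, Or.inl ha, Or.inl hb⟩

variable [Fintype V]

lemma muct_subset (h : G.IsCutTo Y A H) : H.muct Y ⊆ A :=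
  muct_induction h.mem_verts h.mem (fun _ _ _ _ _ hvw => ((h.dir_iff _ _).1 hvw).2)
    fun _ _ _ _ _ hvw => ((h.bi_iff _ _).1 hvw).2.2

lemma isTerritory_muct (h : G.IsCutTo Y A H) : G.IsTerritory Y (H.muct Y) where
  mem := mem_muct_self h.mem_verts
  muct_induce := by
    have hYT : Y ∈ H.muct Y := mem_muct_self h.mem_verts
    have hYH : Y ∈ (H.induce (H.muct Y)).verts := Finset.mem_inter.2 ⟨h.mem_verts, hYT⟩
    have hYG : Y ∈ (G.induce (H.muct Y)).verts :=
      Finset.mem_inter.2 ⟨h.verts_subset h.mem_verts, hYT⟩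
    have hA {v : V} (hv : v ∈ H.muct Y) : v ∈ A := h.muct_subset hv
    refine Eq.trans (Finset.Subset.antisymm (muct_mono hYG hYH ?_ ?_) (muct_mono hYH hYG ?_ ?_))
      (muct_induce_muct h.mem_verts)
    · exact fun a b ⟨hab, ha, hb⟩ => ⟨(h.dir_iff a b).2 ⟨hab, hA hb⟩, ha, hb⟩
    · exact fun a b ⟨hab, ha, hb⟩ => ⟨(h.bi_iff a b).2 ⟨hab, hA ha, hA hb⟩, ha, hb⟩
    · exact fun a b ⟨hab, hmem⟩ => ⟨((h.dir_iff a b).1 hab).1, hmem⟩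
    · exact fun a b ⟨hab, hmem⟩ => ⟨((h.bi_iff a b).1 hab).1, hmem⟩

lemma subset_muct (h : G.IsCutTo Y A H) (hT : G.IsTerritory Y T) (hTA : T ⊆ A) :
    T ⊆ H.muct Y := by
  refine hT.muct_induce.symm.subset.trans (muct_mono hT.mem_verts_induce h.mem_verts ?_ ?_)
  · exact fun a b ⟨hab, _, hb⟩ => (h.dir_iff a b).2 ⟨hab, hTA hb⟩
  · exact fun a b ⟨hab, ha, hb⟩ => (h.bi_iff a b).2 ⟨hab, hTA ha, hTA hb⟩

lemma interventionalBorder_eq (h : G.IsCutTo Y A H) :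
    H.interventionalBorder Y = G.border (H.muct Y) := by
  change H.border (H.muct Y) = G.border (H.muct Y)
  ext v
  simp only [mem_border, h.dir_iff]
  exact and_congr_right fun _ => exists_congr fun t => and_congr_right fun ht =>
    and_iff_left (h.muct_subset ht)

end IsCutTo

lemma isCutTo_cutIncoming [Fintype V] [DecidableEq V] (hY : Y ∈ G.verts) {R : Finset V}
    (hR : Y ∉ R) :
    G.IsCutTo Y Rᶜ (G.cutIncoming R) where
  mem := Finset.mem_compl.2 hR
  mem_verts := hY
  verts_subset := Finset.Subset.rfl
  dir_iff a b := by simp only [cutIncoming, Finset.mem_compl]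
  bi_iff a b := by simp only [cutIncoming, Finset.mem_compl]

end Cut

section TopologicalSort

variable {V : Type u} {G : CausalDiagram V} {a b : V}

lemma exists_isTopologicalSort (G : CausalDiagram V) : ∃ l : List V, G.IsTopologicalSort l := by
  classical
  have : IsPartialOrder V (ReflTransGen G.dir) :=
    { antisymm := fun a b hab hba => by
        rcases hab.cases_head with rfl | ⟨c, hac, hcb⟩
        · rfl
        · exact absurd (TransGen.head' hac (hcb.trans hba)) (G.acyclic a) }
  obtain ⟨s, _, hs⟩ := extend_partialOrder (ReflTransGen G.dir)
  refine ⟨G.verts.sort s, G.verts.sort_nodup s, fun v => G.verts.mem_sort s, ?_⟩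
  refine ((G.verts.pairwise_sort s).and (G.verts.sort_nodup s)).imp fun ⟨hab, hne⟩ hba => ?_
  exact hne (antisymm_of s hab (hs _ _ (ReflTransGen.single hba)))

variable [DecidableEq V] {l : List V}

lemma IsTopologicalSort.idxOf_lt_idxOf (hl : G.IsTopologicalSort l) (hab : G.dir a b) :
    l.idxOf a < l.idxOf b := by
  obtain ⟨-, hmem, hpair⟩ := hl
  have ha := List.idxOf_lt_length_of_mem ((hmem a).2 (G.dir_mem a b hab).1)
  have hb := List.idxOf_lt_length_of_mem ((hmem b).2 (G.dir_mem a b hab).2)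
  by_contra! hle
  rcases hle.lt_or_eq with hlt | heq
  · refine List.pairwise_iff_getElem.1 hpair _ _ hb ha hlt ?_
    rwa [List.getElem_idxOf, List.getElem_idxOf]
  · rw [List.idxOf_inj ((hmem b).2 (G.dir_mem a b hab).2)] at heq
    exact G.acyclic a (TransGen.single (heq ▸ hab))

lemma pairwise_idxOf_lt_idxOf_reverse (hl : l.Nodup) :
    l.reverse.Pairwise fun a b => l.idxOf b < l.idxOf a := by
  rw [List.pairwise_reverse, List.pairwise_iff_getElem]
  intro i j hi hj hij
  rwa [hl.idxOf_getElem, hl.idxOf_getElem]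

end TopologicalSort

section Enumeration

variable {V : Type u}

/-- The state of the enumeration on its way to the territory `S`: the edges of the current diagram
are cut to `A`, the vertices of `π` are still to be treated and those of `O` have been passed over.
The vertices are numbered by `rank` in a topological order, along which `π` runs backwards. -/
structure IsEnumState [DecidableEq V] (G : CausalDiagram V) (rank : V → ℕ) (S A O : Finset V)
    (π : List V) : Prop where
  subset : S ⊆ A
  rank_lt : ∀ a b, G.dir a b → b ∈ A → rank a < rank b
  pairwise : π.Pairwise fun a b => rank b < rank a
  notMem_border : ∀ o ∈ O, o ∉ G.border S
  rank_lt_passed : ∀ o ∈ O, ∀ a ∈ π, rank a < rank o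
  mem_list : ∀ x ∈ G.border S, x ∈ A → x ∈ π

variable [DecidableEq V] {G H : CausalDiagram V} {Y p : V} {rank : V → ℕ}
  {A O R S T : Finset V} {π l : List V}

namespace IsEnumState

lemma skip (h : G.IsEnumState rank S A O (p :: π)) (hp : p ∉ G.border S) :
    G.IsEnumState rank S A (O ∪ {p}) π where
  subset := h.subset
  rank_lt := h.rank_lt
  pairwise := h.pairwise.of_cons
  notMem_border o ho := by
    rcases Finset.mem_union.1 ho with ho | ho
    · exact h.notMem_border o ho
    · exact Finset.mem_singleton.1 ho ▸ hp
  rank_lt_passed o ho a ha := by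
    rcases Finset.mem_union.1 ho with ho | ho
    · exact h.rank_lt_passed o ho a (List.mem_cons_of_mem _ ha)
    · exact Finset.mem_singleton.1 ho ▸ List.rel_of_pairwise_cons h.pairwise ha
  mem_list x hx hxA := List.mem_of_ne_of_mem (ne_of_mem_of_not_mem hx hp) (h.mem_list x hx hxA)

lemma descend (h : G.IsEnumState rank S A O (p :: π)) (hST : S ⊆ T) (hTA : T ⊆ A) (hp : p ∉ T) :
    G.IsEnumState rank S T O π where
  subset := hST
  rank_lt a b hab hb := h.rank_lt a b hab (hTA hb)
  pairwise := h.pairwise.of_cons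
  notMem_border := h.notMem_border
  rank_lt_passed o ho a ha := h.rank_lt_passed o ho a (List.mem_cons_of_mem _ ha)
  mem_list x hx hxT :=
    List.mem_of_ne_of_mem (ne_of_mem_of_not_mem hxT hp) (h.mem_list x hx (hTA hxT))

variable [Fintype V]

-- A vertex of `border T ∩ O` precedes a vertex `t ∈ T \ S`, hence also the vertex of `border S`
-- where the path from `t` to `Y` enters `S`; but that vertex is in `π` and so comes before `O`.
lemma border_inter_eq_empty (h : G.IsEnumState rank S T O π) (hT : G.IsTerritory Y T)
    (hY : Y ∈ S) : G.border T ∩ O = ∅ := by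
  rw [← Finset.disjoint_iff_inter_eq_empty, Finset.disjoint_left]
  intro q hqT hqO
  obtain ⟨hqT, t, htT, hqt⟩ := mem_border.1 hqT
  have htS : t ∉ S := fun htS =>
    h.notMem_border q hqO (mem_border.2 ⟨fun hqS => hqT (h.subset hqS), t, htS, hqt⟩)
  obtain ⟨x, hx, htx⟩ := exists_mem_border_of_reflTransGen (hT.path htT) hY htS
  obtain ⟨hxS, hxT⟩ := Finset.mem_inter.1 (border_induce_subset hx)
  have rank_le : rank t ≤ rank x :=
    htx.trans_induction_on (fun _ => le_rfl) (fun hab => (h.rank_lt _ _ hab.1 hab.2.2).le)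
      fun _ _ => le_trans
  exact ((h.rank_lt q t hqt htT).trans_le rank_le).not_gt
    (h.rank_lt_passed q hqO x (h.mem_list x hxS hxT))

end IsEnumState

variable [Fintype V]

lemma mem_between : R ∈ G.between S T ↔ S ⊆ R ∧ R ⊆ G.ancestors T \ T := by
  simp only [between, Finset.mem_filter, Finset.mem_univ, true_and]

lemma exists_isTerritory_of_mem_subPOISs (hH : G.IsCutTo Y A H) (hY : Y ∉ π)
    (hR : R ∈ G.subPOISs Y H π O) : ∃ T, G.IsTerritory Y T ∧ R ∈ G.between (G.border T) T := by
  induction π generalizing H A O with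
  | nil => exact absurd hR (Finset.notMem_empty R)
  | cons p π ih =>
    obtain ⟨hYp, hYπ⟩ := List.ne_and_not_mem_of_not_mem_cons hY
    have hp := hH.cutIncoming_singleton hYp.symm
    simp only [subPOISs, hp.interventionalBorder_eq, Finset.mem_union] at hR
    rcases hR with hR | hR
    · split_ifs at hR with hO hπ
      · rcases Finset.mem_union.1 hR with hR | hR
        · exact ⟨_, hp.isTerritory_muct, hR⟩
        · have hTA := hp.muct_subset.trans (Finset.erase_subset p A)
          exact ih (hH.induce_border hp.isTerritory_muct.mem hTA) hYπ hR
      · rw [Finset.union_empty] at hR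
        exact ⟨_, hp.isTerritory_muct, hR⟩
      · exact absurd hR (Finset.notMem_empty R)
    · exact ih hH hYπ hR

lemma between_subset_subPOISs (hS : G.IsTerritory Y S) (hH : G.IsCutTo Y A H)
    (hstate : G.IsEnumState rank S A O π) (hY : Y ∉ π) (hπ : ∃ x ∈ G.border S, x ∈ π) :
    G.between (G.border S) S ⊆ G.subPOISs Y H π O := by
  induction π generalizing H A O with
  | nil => simp at hπ
  | cons p π ih =>
    obtain ⟨hYp, hYπ⟩ := List.ne_and_not_mem_of_not_mem_cons hY
    have hp := hH.cutIncoming_singleton hYp.symm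
    simp only [subPOISs, hp.interventionalBorder_eq]
    by_cases hpS : p ∈ G.border S
    · refine subset_trans ?_ Finset.subset_union_left
      have hT := hp.isTerritory_muct
      have hTA := hp.muct_subset.trans (Finset.erase_subset p A)
      have hpT := fun h => Finset.notMem_erase p A (hp.muct_subset h)
      have hST := hp.subset_muct hS
        (Finset.subset_erase.2 ⟨hstate.subset, (mem_border.1 hpS).1⟩)
      have hstate' := hstate.descend hST hTA hpT
      rw [if_pos (hstate'.border_inter_eq_empty hT hS.mem)]
      by_cases hTS : Disjoint (G.border S) ((H.cutIncoming {p}).muct Y)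
      · rw [hST.antisymm (hT.subset_of_disjoint_border hS.mem hTS)]
        exact Finset.subset_union_left
      · obtain ⟨x, hxS, hxT⟩ := Finset.not_disjoint_iff.1 hTS
        have hxπ := hstate'.mem_list x hxS hxT
        rw [if_pos (List.ne_nil_of_mem hxπ)]
        exact (ih (hH.induce_border hT.mem hTA) hstate' hYπ ⟨x, hxS, hxπ⟩).trans
          Finset.subset_union_right
    · obtain ⟨x, hxS, hxπ⟩ := hπ
      have hxπ' := List.mem_of_ne_of_mem (ne_of_mem_of_not_mem hxS hpS) hxπ
      exact (ih hH (hstate.skip hpS) hYπ ⟨x, hxS, hxπ'⟩).trans Finset.subset_union_right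

lemma isCutTo_startDiagram (hY : Y ∈ G.verts) :
    G.IsCutTo Y (G.muct Y) (G.startDiagram Y) := by
  have hG := isCutTo_self hY
  rw [startDiagram, hG.interventionalBorder_eq]
  exact hG.induce_border (mem_muct_self hY) hG.muct_subset

lemma isEnumState_startDiagram (hY : Y ∈ G.verts) (hS : G.IsTerritory Y S)
    (hl : (G.startDiagram Y).IsTopologicalSort l) :
    G.IsEnumState (fun v => l.idxOf v) S (G.muct Y) ∅ (l.reverse.filter (· ≠ Y)) where
  subset := (isCutTo_self hY).subset_muct hS (Finset.subset_univ S)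
  rank_lt a b hab hb := hl.idxOf_lt_idxOf (((isCutTo_startDiagram hY).dir_iff a b).2 ⟨hab, hb⟩)
  pairwise := (pairwise_idxOf_lt_idxOf_reverse hl.1).filter _
  notMem_border o ho := absurd ho (Finset.notMem_empty o)
  rank_lt_passed o ho := absurd ho (Finset.notMem_empty o)
  mem_list x hx hxT := by
    have hxG : x ∈ G.verts := muct_subset_verts hxT
    have hxQ : x ∈ (G.startDiagram Y).verts :=
      Finset.mem_inter.2 ⟨hxG, Finset.mem_union_left _ hxT⟩
    have hxY : x ≠ Y := (ne_of_mem_of_not_mem hS.mem (mem_border.1 hx).1).symm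
    exact List.mem_filter.2 ⟨List.mem_reverse.2 ((hl.2.1 x).2 hxQ), decide_eq_true hxY⟩

theorem mem_POISs_iff (hY : Y ∈ G.verts) (hl : (G.startDiagram Y).IsTopologicalSort l) :
    R ∈ G.POISs Y l ↔ ∃ T, G.IsTerritory Y T ∧ R ∈ G.between (G.border T) T := by
  have hG := isCutTo_self hY
  have hT := hG.isTerritory_muct
  have hYπ : Y ∉ l.reverse.filter (· ≠ Y) := by simp
  rw [POISs, Finset.mem_union, hG.interventionalBorder_eq]
  constructor
  · rintro (hR | hR)
    · exact ⟨_, hT, hR⟩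
    · exact exists_isTerritory_of_mem_subPOISs (isCutTo_startDiagram hY) hYπ hR
  · rintro ⟨S, hS, hR⟩
    have hstate := isEnumState_startDiagram hY hS hl
    by_cases hST : Disjoint (G.border S) (G.muct Y)
    · exact Or.inl
        (hstate.subset.antisymm (hT.subset_of_disjoint_border hS.mem hST) ▸ hR)
    · obtain ⟨x, hxS, hxT⟩ := Finset.not_disjoint_iff.1 hST
      exact Or.inr (between_subset_subPOISs hS (isCutTo_startDiagram hY) hstate hYπ
        ⟨x, hxS, hstate.mem_list x hxS hxT⟩ hR)

end Enumeration

end CausalDiagram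

namespace SCM

open CausalDiagram

section Solve

variable {V : Type u} [DecidableEq V] {Y v : V} {G : CausalDiagram V} {M : SCM V Y}
  {R T W X : Finset V} {r w x : ∀ v, M.Dom v} {e e' : ∀ j, M.U j}

lemma solve_of_mem (hv : v ∈ X) : M.solve X x e v = x v := by
  rw [solve_eq, if_pos hv]

lemma solve_of_notMem (hv : v ∉ X) :
    M.solve X x e v = M.f v (fun p => M.solve X x e p.1) (fun j => e j.1) := by
  rw [solve_eq, if_neg hv]

lemma solve_congr_of_border (hM : M.Conforms G) (hR : Disjoint R T) (hW : Disjoint W T)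
    (border : ∀ b ∈ G.border T, M.solve R r e b = M.solve W w e' b)
    (exogenous : ∀ j, ∀ t ∈ T, t ∈ M.scope j → e j = e' j) :
    ∀ t ∈ T, M.solve R r e t = M.solve W w e' t := by
  intro t ht
  induction t using M.wf.induction with
  | _ t ih =>
    rw [solve_of_notMem (Finset.disjoint_right.1 hR ht),
      solve_of_notMem (Finset.disjoint_right.1 hW ht)]
    congr 1
    · funext ⟨p, hp⟩
      exact (mem_or_mem_border ((hM.1 p t).2 hp) ht).elim (ih p hp) (border p)
    · exact funext fun j => exogenous j t ht j.2

lemma expectedReward_eq_of_forall {d : M.Dom Y} (h : ∀ e, M.solve X x e Y = d) :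
    M.expectedReward X x = M.value d := by
  simp only [expectedReward, h, integral_const, probReal_univ, one_smul]

lemma rewardEquivalent_of_border_subset (hY : Y ∈ T) (hTR : G.border T ⊆ R)
    (hTW : G.border T ⊆ W) (hR : Disjoint R T) (hW : Disjoint W T) :
    RewardEquivalent G Y R W := by
  intro M hM x
  refine integral_congr_ae (Filter.Eventually.of_forall fun e => congrArg M.value ?_)
  refine solve_congr_of_border hM hR hW (fun b hb => ?_) (fun _ _ _ _ => rfl) Y hY
  rw [solve_of_mem (hTR hb), solve_of_mem (hTW hb)]

end Solve

lemma expectedReward_le_bestReward {V : Type u} [Finite V] [DecidableEq V] {Y : V} (M : SCM V Y)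
    (X : Finset V) (x : ∀ v, M.Dom v) : M.expectedReward X x ≤ M.bestReward X :=
  le_ciSup (Set.finite_range fun x => M.expectedReward X x).bddAbove x

section InterventionalBorder

variable {V : Type u} [Fintype V] [DecidableEq V] {Y : V} {G : CausalDiagram V} {M : SCM V Y}
  {R : Finset V} {r : ∀ v, M.Dom v}

-- Outside the territory `T`, the ancestors of `Y` in the cut diagram share no exogenous variable
-- with `T` and have no parent in it.
lemma solve_border_congr (hM : M.Conforms G) (hY : Y ∈ G.verts) (hR : Y ∉ R) {e e' : ∀ j, M.U j}
    (he : ∀ j, (∀ t ∈ (G.cutIncoming R).muct Y, t ∉ M.scope j) → e j = e' j) {b : V}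
    (hb : b ∈ G.border ((G.cutIncoming R).muct Y)) : M.solve R r e b = M.solve R r e' b := by
  set K := G.cutIncoming R
  have hYK : Y ∈ K.verts := hY
  have hTR {t : V} (ht : t ∈ K.muct Y) : t ∉ R :=
    Finset.mem_compl.1 ((isCutTo_cutIncoming hY hR).muct_subset ht)
  set S := K.ancestors {Y} \ (R ∪ K.muct Y) with hS
  have mem_S {v : V} : v ∈ S ↔ ReflTransGen K.dir v Y ∧ v ∉ R ∧ v ∉ K.muct Y := by
    rw [hS, Finset.mem_sdiff, mem_ancestors_singleton hYK, Finset.mem_union, not_or]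
  have border_S {c : V} (hc : c ∈ G.border S) : c ∈ R := by
    obtain ⟨hcS, s, hs, hcs⟩ := mem_border.1 hc
    obtain ⟨hsY, hsR, hsT⟩ := mem_S.1 hs
    by_contra hcR
    exact hcS (mem_S.2 ⟨hsY.head ⟨hcs, hsR⟩, hcR, fun hcT =>
      hsT (mem_muct_of_dir hYK hcT ⟨hcs, hsR⟩ hsY)⟩)
  have exogenous : ∀ j, ∀ s ∈ S, s ∈ M.scope j → e j = e' j := by
    intro j s hs hsj
    obtain ⟨hsY, hsR, hsT⟩ := mem_S.1 hs
    refine he j fun t ht htj => hsT (mem_muct_of_bi hYK ht ⟨?_, hTR ht, hsR⟩ hsY)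
    exact (hM.2 t s).2 ⟨ne_of_mem_of_not_mem ht hsT, j, htj, hsj⟩
  have hRS : Disjoint R S := Finset.disjoint_right.2 fun v hv => (mem_S.1 hv).2.1
  obtain ⟨hbT, t, ht, hbt⟩ := mem_border.1 hb
  by_cases hbR : b ∈ R
  · rw [solve_of_mem hbR, solve_of_mem hbR]
  · refine solve_congr_of_border hM hRS hRS (fun c hc => ?_) exogenous b
      (mem_S.2 ⟨(reflTransGen_of_mem_muct hYK ht).head ⟨hbt, hTR ht⟩, hbR, hbT⟩)
    rw [solve_of_mem (border_S hc), solve_of_mem (border_S hc)]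

lemma solve_piecewise_eq_solve_border (hM : M.Conforms G) (hY : Y ∈ G.verts) (hR : Y ∉ R)
    (e a : ∀ j, M.U j) {s : Set M.J} [∀ j, Decidable (j ∈ s)]
    (hs : ∀ j, j ∈ s ↔ ∃ t ∈ (G.cutIncoming R).muct Y, t ∈ M.scope j) :
    M.solve R r (s.piecewise e a) Y =
      M.solve (G.border ((G.cutIncoming R).muct Y)) (M.solve R r a) e Y := by
  refine solve_congr_of_border hM (Finset.subset_compl_iff_disjoint_left.1
    (isCutTo_cutIncoming hY hR).muct_subset) disjoint_border (fun b hb => ?_) (fun j t ht htj => ?_)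
    Y (mem_muct_self hY)
  · rw [solve_of_mem hb]
    refine solve_border_congr hM hY hR (fun j hj => Set.piecewise_eq_of_notMem _ _ _ ?_) hb
    exact fun hjs => ((hs j).1 hjs).elim fun t ht => hj t ht.1 ht.2
  · exact Set.piecewise_eq_of_mem _ _ _ ((hs j).2 ⟨t, ht, htj⟩)

lemma bestReward_le_bestReward_border (hM : M.Conforms G) (hY : Y ∈ G.verts) (hR : Y ∉ R) :
    M.bestReward R ≤ M.bestReward (G.border ((G.cutIncoming R).muct Y)) := by
  classical
  let s : Set M.J := {j | ∃ t ∈ (G.cutIncoming R).muct Y, t ∈ M.scope j}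
  refine ciSup_le fun r => ?_
  obtain ⟨a, ha⟩ := exists_integral_pi_le_integral_piecewise M.P s (M.integrable_reward R r)
  have hsolve e := congrArg M.value <|
    solve_piecewise_eq_solve_border (r := r) (s := s) hM hY hR e a fun _ => Iff.rfl
  exact (ha.trans_eq (integral_congr_ae (.of_forall hsolve))).trans
    (M.expectedReward_le_bestReward _ (M.solve R r a))

end InterventionalBorder

end SCM

namespace CausalDiagram

section CoinModel

variable {V : Type u}

open Classical in
/-- The readers of the coin attached to the pair `j`: its two members if they are joined by a
bidirected edge, and nobody otherwise. -/
noncomputable def coinReaders (G : CausalDiagram V) (j : V × V) : Finset V :=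
  if G.bi j.1 j.2 then {j.1, j.2} else ∅

lemma mem_coinReaders {G : CausalDiagram V} {j : V × V} {v : V} :
    v ∈ G.coinReaders j ↔ G.bi j.1 j.2 ∧ (v = j.1 ∨ v = j.2) := by
  classical
  by_cases h : G.bi j.1 j.2 <;> simp [coinReaders, h]

lemma bi_iff_exists_mem_coinReaders {G : CausalDiagram V} {a b : V} :
    G.bi a b ↔ a ≠ b ∧ ∃ j, a ∈ G.coinReaders j ∧ b ∈ G.coinReaders j := by
  simp only [mem_coinReaders]
  constructor
  · intro h
    exact ⟨fun hab => G.bi_irrefl a (hab ▸ h), (a, b), ⟨h, .inl rfl⟩, h, .inr rfl⟩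
  · rintro ⟨hab, j, ⟨hj, rfl | rfl⟩, -, rfl | rfl⟩
    exacts [absurd rfl hab, hj, G.bi_symm _ _ hj, absurd rfl hab]

lemma mem_parents_singleton {G : CausalDiagram V} {p v : V} :
    p ∈ G.parents {v} ↔ G.dir p v := by
  simp only [parents, Finset.mem_filter, Finset.mem_singleton, exists_eq_left]
  exact and_iff_right_of_imp fun h => (G.dir_mem _ _ h).1

variable [Fintype V] {D : Type} [Fintype D] [Nonempty D]

/-- The model with diagram `G` and a common domain `D`, whose exogenous variables are independent
fair coins, one for each pair of vertices joined by a bidirected edge. -/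
noncomputable def coinModel (G : CausalDiagram V) (Y : V) (value : D ↪ ℝ)
    (f : ∀ v, ({p // p ∈ G.parents {v}} → D) → ({j // v ∈ G.coinReaders j} → Bool) → D) :
    SCM V Y where
  Dom _ := D
  value := value
  J := V × V
  U _ := Bool
  P _ := (PMF.uniformOfFintype Bool).toMeasure
  pa v := G.parents {v}
  wf := G.wellFounded_dir.mono fun _ _ => mem_parents_singleton.1
  scope := G.coinReaders
  f := f
  f_meas _ _ _ := (Set.toFinite _).measurableSet

variable {G : CausalDiagram V} {Y : V} {value : D ↪ ℝ}
  {f : ∀ v, ({p // p ∈ G.parents {v}} → D) → ({j // v ∈ G.coinReaders j} → Bool) → D}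

lemma coinModel_conforms : (G.coinModel Y value f).Conforms G :=
  ⟨fun _ _ => mem_parents_singleton.symm, fun _ _ => bi_iff_exists_mem_coinReaders⟩

lemma expectedReward_coinModel_lt [DecidableEq V] {W : Finset V} {x : V → D} {c : ℝ}
    (hle : ∀ e : V × V → Bool, value ((G.coinModel Y value f).solve W x e Y) ≤ c)
    (hlt : ∃ e : V × V → Bool, value ((G.coinModel Y value f).solve W x e Y) < c) :
    (G.coinModel Y value f).expectedReward W x < c := by
  obtain ⟨e, he⟩ := hlt
  refine integral_lt_of_forall_le_of_exists_lt
    (μ := Measure.pi fun _ : V × V => (PMF.uniformOfFintype Bool).toMeasure) hle he ?_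
  rw [Measure.pi_singleton, Finset.prod_ne_zero_iff]
  intro j _
  rw [PMF.toMeasure_apply_singleton _ _ (measurableSet_singleton _)]
  exact (PMF.mem_support_iff _ _).1 (PMF.mem_support_uniformOfFintype _)

end CoinModel

section Detour

variable {V : Type u} [DecidableEq V] {G : CausalDiagram V} {Y v : V} {T W : Finset V}

/-- Some directed path from `v` to `Y` inside `T` meets `W`; here `s` is its last vertex in `W` and
`d` the successor of `s`. Interventions on `W` can interfere with `Y` along such a path. -/
def ReachesThrough (G : CausalDiagram V) (Y : V) (T W : Finset V) (v : V) : Prop :=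
  ∃ s ∈ W, ∃ d, ReflTransGen (G.induce T).dir v s ∧ G.dir s d ∧
    ReflTransGen (G.induce (T \ W)).dir d Y

lemma notMem_of_reflTransGen_induce_sdiff (hW : Y ∉ W)
    (h : ReflTransGen (G.induce (T \ W)).dir v Y) : v ∉ W := by
  rcases h.cases_head with rfl | ⟨w, hvw, -⟩
  exacts [hW, (Finset.mem_sdiff.1 hvw.2.1).2]

variable [Fintype V]

lemma IsTerritory.reflTransGen_or_reachesThrough (hT : G.IsTerritory Y T) (hW : Y ∉ W)
    (hv : v ∈ T) : ReflTransGen (G.induce (T \ W)).dir v Y ∨ G.ReachesThrough Y T W v := by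
  have hp := hT.path hv
  induction hp using ReflTransGen.head_induction_on with
  | refl => exact .inl .refl
  | @head v w hvw _ ih =>
    rcases ih hvw.2.2 with hwY | ⟨s, hs, d, hws, hsd⟩
    · by_cases hvW : v ∈ W
      · exact .inr ⟨v, hvW, w, .refl, hvw.1, hwY⟩
      · exact .inl (hwY.head ⟨hvw.1, Finset.mem_sdiff.2 ⟨hvw.2.1, hvW⟩,
          Finset.mem_sdiff.2 ⟨hvw.2.2, notMem_of_reflTransGen_induce_sdiff hW hwY⟩⟩)
    · exact .inr ⟨s, hs, d, hws.head hvw, hsd⟩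

-- Otherwise not reaching `Y` through `W` would pass from `Y` to all of the territory.
lemma IsTerritory.exists_bi_reachesThrough (hT : G.IsTerritory Y T) (hW : Y ∉ W)
    (hWT : ¬ Disjoint W T) :
    ∃ a, ∃ b ∈ T, G.bi a b ∧ ReflTransGen (G.induce (T \ W)).dir a Y ∧
      G.ReachesThrough Y T W b := by
  by_contra! hno
  have not_reaches : ∀ v ∈ T, ¬ G.ReachesThrough Y T W v := by
    refine hT.induction ?_ ?_ fun v hvT hv w hwT hvw => hno v w hwT hvw
      ((hT.reflTransGen_or_reachesThrough hW hvT).resolve_right hv)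
    · rintro ⟨s, -, d, hYs, hsd, hdY⟩
      exact G.acyclic Y ((TransGen.tail' (reflTransGen_of_induce hYs) hsd).trans_left
        (reflTransGen_of_induce hdY))
    · rintro v hvT hv w hwT hvw ⟨s, hs, d, hws, hsd⟩
      exact hv ⟨s, hs, d, hws.head ⟨hvw, hvT, hwT⟩, hsd⟩
  obtain ⟨v, hvW, hvT⟩ := Finset.not_disjoint_iff.1 hWT
  exact notMem_of_reflTransGen_induce_sdiff hW
    ((hT.reflTransGen_or_reachesThrough hW hvT).resolve_right (not_reaches v hvT)) hvW

end Detour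

section Relay

variable {V : Type u} [DecidableEq V] {E : Type}

/-- The vertex `p` has to report the coin `j`: some reader of `j` has a directed path to `p`
inside `T`. -/
def Reports (G : CausalDiagram V) (T : Finset V) (p : V) (j : V × V) : Prop :=
  ∃ b ∈ T, b ∈ G.coinReaders j ∧ ReflTransGen (G.induce T).dir b p

variable {G : CausalDiagram V} {Y : V} {R T W : Finset V} {p v : V} {j : V × V}

lemma Reports.mem (h : G.Reports T p j) : p ∈ T := by
  obtain ⟨b, hb, -, hbp⟩ := h
  rcases hbp.cases_tail with rfl | ⟨c, -, hcp⟩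
  exacts [hb, hcp.2.2]

lemma Reports.cases_tail (h : G.Reports T v j) :
    v ∈ G.coinReaders j ∨ ∃ p, (G.induce T).dir p v ∧ G.Reports T p j := by
  obtain ⟨b, hb, hbj, hbv⟩ := h
  rcases hbv.cases_tail with rfl | ⟨p, hbp, hpv⟩
  exacts [.inl hbj, .inr ⟨p, hpv, b, hb, hbj, hbp⟩]

/-- What the vertex `v` learns about the coins from the claims `c` of its parents and from the coins
`u` that it reads. The claim `(i, b)` says that coin number `i` shows `b`. Nothing is ruled out (all
claims are collected) by a vertex outside `T` and by one that misses a report. -/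
def collect (G : CausalDiagram V) (T : Finset V) (number : V × V ↪ E) (v : V)
    (c : {p // p ∈ G.parents {v}} → Set (E × Bool)) (u : {j // v ∈ G.coinReaders j} → Bool) :
    Set (E × Bool) :=
  {i | v ∉ T ∨
    (∃ p : {p // p ∈ G.parents {v}}, ∃ j, G.Reports T p j ∧ ∀ b, (number j, b) ∉ c p) ∨
    (∃ p, i ∈ c p) ∨ ∃ j : {j // v ∈ G.coinReaders j}, i = (number j, u j)}

variable [Fintype V] [Fintype E]

open Classical in
/-- The coin model in which every vertex passes on the claims that it has collected, and in which
the value of `Y` is `∅` or the set of all claims, according to whether or not the claims collected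
by `Y` are free of contradictions. -/
noncomputable def relayModel (G : CausalDiagram V) (Y : V) (T : Finset V) (number : V × V ↪ E)
    (value : Set (E × Bool) ↪ ℝ) : SCM V Y :=
  G.coinModel Y value fun v c u =>
    if v = Y then
      if Set.InjOn Prod.fst (G.collect T number v c u) then ∅ else Set.univ
    else G.collect T number v c u

/-- The claims that `v` makes, that is, the value of `v`, in the relay model under the intervention
`do(W = x[W])`. -/
noncomputable def claims (G : CausalDiagram V) (Y : V) (T : Finset V) (number : V × V ↪ E)
    (value : Set (E × Bool) ↪ ℝ) (W : Finset V) (x : V → Set (E × Bool)) (e : V × V → Bool) :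
    V → Set (E × Bool) :=
  (G.relayModel Y T number value).solve W x e

/-- The claims that `v` collects in the relay model under the intervention `do(W = x[W])`. -/
noncomputable def collected (G : CausalDiagram V) (Y : V) (T : Finset V) (number : V × V ↪ E)
    (value : Set (E × Bool) ↪ ℝ) (W : Finset V) (x : V → Set (E × Bool)) (e : V × V → Bool)
    (v : V) : Set (E × Bool) :=
  G.collect T number v (fun p => G.claims Y T number value W x e p) fun j => e j

variable {number : V × V ↪ E} {value : Set (E × Bool) ↪ ℝ} {x : V → Set (E × Bool)}
  {e : V × V → Bool} {b : Bool} {i : E × Bool}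

lemma mem_collected : i ∈ G.collected Y T number value W x e v ↔
    v ∉ T ∨
      (∃ p, G.dir p v ∧ ∃ j, G.Reports T p j ∧
        ∀ b, (number j, b) ∉ G.claims Y T number value W x e p) ∨
      (∃ p, G.dir p v ∧ i ∈ G.claims Y T number value W x e p) ∨
      ∃ j, v ∈ G.coinReaders j ∧ i = (number j, e j) := by
  simp only [collected, collect, Set.mem_ofPred_eq, Subtype.exists, mem_parents_singleton,
    exists_prop]

lemma claims_of_notMem (hW : v ∉ W) (hv : v ≠ Y) :
    G.claims Y T number value W x e v = G.collected Y T number value W x e v :=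
  (SCM.solve_of_notMem hW).trans (if_neg hv)

open Classical in
lemma claims_self (hY : Y ∉ W) :
    G.claims Y T number value W x e Y =
      if Set.InjOn Prod.fst (G.collected Y T number value W x e Y) then ∅ else Set.univ :=
  (SCM.solve_of_notMem hY).trans (if_pos rfl)

lemma collected_subset (hpv : G.dir p v) (hp : p ∉ W) (hY : p ≠ Y) :
    G.collected Y T number value W x e p ⊆ G.collected Y T number value W x e v := by
  intro i hi
  rw [← claims_of_notMem hp hY] at hi
  exact mem_collected.2 (.inr (.inr (.inl ⟨p, hpv, hi⟩)))

lemma collected_subset_of_path (h : ReflTransGen (G.induce (T \ W)).dir v Y) :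
    G.collected Y T number value W x e v ⊆ G.collected Y T number value W x e Y := by
  induction h using ReflTransGen.head_induction_on with
  | refl => exact subset_rfl
  | head hvw hwY ih =>
    exact (collected_subset hvw.1 (Finset.mem_sdiff.1 hvw.2.1).2
      (ne_of_dir_of_reflTransGen hvw.1 (reflTransGen_of_induce hwY))).trans ih

-- A parent that keeps silent about a coin is as good as one that contradicts every claim.
lemma mem_collected_not (hpv : G.dir p v) (hj : G.Reports T p j)
    (hp : (number j, b) ∉ G.claims Y T number value W x e p) :
    (number j, !b) ∈ G.collected Y T number value W x e v := by
  by_cases h : (number j, !b) ∈ G.claims Y T number value W x e p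
  · exact mem_collected.2 (.inr (.inr (.inl ⟨p, hpv, h⟩)))
  · refine mem_collected.2 (.inr (.inl ⟨p, hpv, j, hj, fun b' => ?_⟩))
    rcases Bool.eq_or_eq_not b' b with rfl | rfl
    exacts [hp, h]

lemma IsTerritory.not_injOn_collected_of_not_border_subset (hT : G.IsTerritory Y T)
    (hWT : Disjoint W T) (hW : ¬ G.border T ⊆ W) :
    ¬ Set.InjOn Prod.fst (G.collected Y T number value W x e Y) := by
  obtain ⟨v, hv, hvW⟩ := Finset.not_subset.1 hW
  obtain ⟨hvT, t, ht, hvt⟩ := mem_border.1 hv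
  have htY := hT.path ht
  rw [← Finset.sdiff_eq_self_of_disjoint hWT.symm] at htY
  have key i : i ∈ G.collected Y T number value W x e Y :=
    collected_subset_of_path htY <| collected_subset hvt hvW (ne_of_mem_of_not_mem hT.mem hvT).symm
      (mem_collected.2 (.inl hvT))
  exact not_injOn_fst_of_mem_not (a := number (Y, Y)) (b := true) (key _) (key _)

lemma IsTerritory.exists_not_injOn_collected_of_not_disjoint (hT : G.IsTerritory Y T)
    (hW : Y ∉ W) (hWT : ¬ Disjoint W T) :
    ∃ e, ¬ Set.InjOn Prod.fst (G.collected Y T number value W x e Y) := by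
  classical
  obtain ⟨a, b, hbT, hab, haY, s, hs, d, hbs, hsd, hdY⟩ :=
    hT.exists_bi_reachesThrough hW hWT
  have hj : G.Reports T s (a, b) := ⟨b, hbT, mem_coinReaders.2 ⟨hab, .inr rfl⟩, hbs⟩
  let e (j : V × V) : Bool := decide ((number j, true) ∉ x s)
  have claims_s : G.claims Y T number value W x e s = x s := SCM.solve_of_mem hs
  have read : (number (a, b), e (a, b)) ∈ G.collected Y T number value W x e a :=
    mem_collected.2 (.inr (.inr (.inr ⟨(a, b), mem_coinReaders.2 ⟨hab, .inl rfl⟩, rfl⟩)))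
  have reported : (number (a, b), !e (a, b)) ∈ G.collected Y T number value W x e d := by
    by_cases h : (number (a, b), true) ∈ x s
    · have he : e (a, b) = false := decide_eq_false (not_not.2 h)
      exact mem_collected.2 (.inr (.inr (.inl ⟨s, hsd, by rwa [he, claims_s]⟩)))
    · have he : e (a, b) = true := decide_eq_true h
      exact mem_collected_not hsd hj (by rwa [he, claims_s])
  exact ⟨e, not_injOn_fst_of_mem_not (collected_subset_of_path haY read)
    (collected_subset_of_path hdY reported)⟩

lemma IsTerritory.collected_subset_range (hT : G.IsTerritory Y T) (hTR : G.border T ⊆ R)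
    (hRT : Disjoint R T) :
    G.collected Y T number value R (fun _ => ∅) e Y ⊆ Set.range fun j => (number j, e j) := by
  suffices ∀ v ∈ T,
      G.collected Y T number value R (fun _ => ∅) e v ⊆ Set.range (fun j => (number j, e j)) ∧
        ∀ j, G.Reports T v j →
          (number j, e j) ∈ G.collected Y T number value R (fun _ => ∅) e v from
    (this Y hT.mem).1
  intro v hv
  induction v using G.wellFounded_dir.induction with
  | _ v ih =>
  have inner {p : V} (hpv : G.dir p v) (hp : p ∈ T) :
      G.claims Y T number value R (fun _ => ∅) e p =
        G.collected Y T number value R (fun _ => ∅) e p :=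
    claims_of_notMem (Finset.disjoint_right.1 hRT hp)
      (ne_of_dir_of_reflTransGen hpv (reflTransGen_of_induce (hT.path hv)))
  have outer {p : V} (hpv : G.dir p v) (hp : p ∉ T) :
      G.claims Y T number value R (fun _ => ∅) e p = ∅ :=
    SCM.solve_of_mem (hTR ((mem_or_mem_border hpv hv).resolve_left hp))
  refine ⟨fun i hi => ?_, fun j hj => mem_collected.2 ?_⟩
  · rcases mem_collected.1 hi with hvT | ⟨p, hpv, j, hj, hno⟩ | ⟨p, hpv, hip⟩ | ⟨j, -, rfl⟩
    · exact absurd hv hvT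
    · exact absurd (inner hpv hj.mem ▸ (ih p hpv hj.mem).2 j hj) (hno _)
    · by_cases hp : p ∈ T
      · exact (ih p hpv hp).1 (inner hpv hp ▸ hip)
      · exact absurd (outer hpv hp ▸ hip) (Set.notMem_empty i)
    · exact Set.mem_range_self j
  · rcases hj.cases_tail with hvj | ⟨p, hpv, hpj⟩
    · exact .inr (.inr (.inr ⟨j, hvj, rfl⟩))
    · exact .inr (.inr (.inl ⟨p, hpv.1, inner hpv.1 hpj.mem ▸ (ih p hpv.1 hpj.mem).2 j hpj⟩))

lemma IsTerritory.injOn_collected (hT : G.IsTerritory Y T) (hTR : G.border T ⊆ R)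
    (hRT : Disjoint R T) :
    Set.InjOn Prod.fst (G.collected Y T number value R (fun _ => ∅) e Y) := by
  intro i hi i' hi' h
  obtain ⟨j, rfl⟩ := hT.collected_subset_range hTR hRT hi
  obtain ⟨j', rfl⟩ := hT.collected_subset_range hTR hRT hi'
  rw [number.injective h]

lemma IsTerritory.exists_not_injOn_collected (hT : G.IsTerritory Y T) (hW : Y ∉ W)
    (h : ¬ (G.border T ⊆ W ∧ Disjoint W T)) :
    ∃ e, ¬ Set.InjOn Prod.fst (G.collected Y T number value W x e Y) := by
  by_cases hWT : Disjoint W T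
  · exact ⟨fun _ => true,
      hT.not_injOn_collected_of_not_border_subset hWT fun hTW => h ⟨hTW, hWT⟩⟩
  · exact hT.exists_not_injOn_collected_of_not_disjoint hW hWT

lemma IsTerritory.expectedReward_relayModel_lt (hT : G.IsTerritory Y T)
    (hvalue : value Set.univ < value ∅) (hW : Y ∉ W) (h : ¬ (G.border T ⊆ W ∧ Disjoint W T)) :
    (G.relayModel Y T number value).expectedReward W x < value ∅ := by
  obtain ⟨e, he⟩ :=
    hT.exists_not_injOn_collected (number := number) (value := value) (x := x) hW h
  refine expectedReward_coinModel_lt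
    (fun e' => (?_ : value (G.claims Y T number value W x e' Y) ≤ value ∅))
    ⟨e, (?_ : value (G.claims Y T number value W x e Y) < value ∅)⟩
  · rw [claims_self hW]
    split_ifs
    exacts [le_rfl, hvalue.le]
  · rwa [claims_self hW, if_neg he]

lemma IsTerritory.bestReward_relayModel_lt (hT : G.IsTerritory Y T)
    (hvalue : value Set.univ < value ∅) (hW : Y ∉ W) (h : ¬ (G.border T ⊆ W ∧ Disjoint W T)) :
    (G.relayModel Y T number value).bestReward W < value ∅ := by
  obtain ⟨x, hx⟩ := exists_eq_ciSup_of_finite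
    (f := fun x => (G.relayModel Y T number value).expectedReward W x)
  exact hx.symm.trans_lt (hT.expectedReward_relayModel_lt hvalue hW h)

lemma IsTerritory.expectedReward_relayModel_eq (hT : G.IsTerritory Y T) (hTR : G.border T ⊆ R)
    (hRT : Disjoint R T) :
    (G.relayModel Y T number value).expectedReward R (fun _ => (∅ : Set (E × Bool))) =
      value ∅ :=
  SCM.expectedReward_eq_of_forall fun _ =>
    (claims_self (Finset.disjoint_right.1 hRT hT.mem)).trans (if_pos (hT.injOn_collected hTR hRT))

end Relay

section Classification

variable {V : Type u} [Fintype V] [DecidableEq V] {G : CausalDiagram V} {Y : V} {R T : Finset V}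

theorem IsTerritory.exists_conforms_bestReward_lt (hT : G.IsTerritory Y T)
    (hTR : G.border T ⊆ R) (hRT : Disjoint R T) :
    ∃ M : SCM V Y, M.Conforms G ∧ ∀ W : Finset V, Y ∉ W →
      ¬ (G.border T ⊆ W ∧ Disjoint W T) → M.bestReward W < M.bestReward R := by
  let number : V × V ↪ Fin (Fintype.card (V × V)) := (Fintype.equivFin _).toEmbedding
  obtain ⟨value, hvalue⟩ := exists_embedding_real_lt
    (Set.nonempty_of_mem (Set.mem_univ (number (Y, Y), true))).ne_empty
  refine ⟨G.relayModel Y T number value, coinModel_conforms, fun W hW h => ?_⟩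
  refine (hT.bestReward_relayModel_lt hvalue hW h).trans_le ?_
  rw [← hT.expectedReward_relayModel_eq hTR hRT]
  exact SCM.expectedReward_le_bestReward _ R _

lemma IsTerritory.border_subset_of_rewardEquivalent (hT : G.IsTerritory Y T) (hR : Y ∉ R)
    (h : RewardEquivalent G Y R (G.border T)) : G.border T ⊆ R := by
  obtain ⟨M, hM, hlt⟩ := hT.exists_conforms_bestReward_lt subset_rfl disjoint_border
  by_contra hTR
  exact (hlt R hR fun hR' => hTR hR'.1).ne (iSup_congr (h M hM))

theorem isPOIS_iff (hY : Y ∈ G.verts) :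
    IsPOIS G Y R ↔ ∃ T, G.IsTerritory Y T ∧ R ∈ G.between (G.border T) T := by
  simp only [mem_between]
  constructor
  · rintro ⟨hRA, M, hM, hbest⟩
    obtain ⟨hRA, hYR⟩ := Finset.subset_sdiff.1 hRA
    rw [Finset.disjoint_singleton_right] at hYR
    have hcut := isCutTo_cutIncoming hY hYR
    have hT := hcut.isTerritory_muct
    have hequiv : RewardEquivalent G Y R (G.border ((G.cutIncoming R).muct Y)) := by
      by_contra hne
      exact (hbest _ (Finset.disjoint_right.1 disjoint_border hT.mem) hne).not_ge
        (SCM.bestReward_le_bestReward_border hM hY hYR)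
    refine ⟨_, hT, hT.border_subset_of_rewardEquivalent hYR hequiv, ?_⟩
    rw [hT.ancestors_eq]
    exact Finset.subset_sdiff.2
      ⟨hRA, Finset.subset_compl_iff_disjoint_left.1 hcut.muct_subset⟩
  · rintro ⟨T, hT, hTR, hRA⟩
    rw [hT.ancestors_eq, Finset.subset_sdiff] at hRA
    obtain ⟨hRA, hRT⟩ := hRA
    obtain ⟨M, hM, hbest⟩ := hT.exists_conforms_bestReward_lt hTR hRT
    refine ⟨Finset.subset_sdiff.2 ⟨hRA, Finset.disjoint_singleton_right.2
      (Finset.disjoint_right.1 hRT hT.mem)⟩, M, hM, fun W hW hne => hbest W hW fun h => hne ?_⟩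
    exact SCM.rewardEquivalent_of_border_subset hT.mem hTR h.1 hRT h.2

end Classification

end CausalDiagram

theorem mainTheorem8_general {V : Type u} [Fintype V] [DecidableEq V] (G : CausalDiagram V)
    (Y : V) (hY : Y ∈ G.verts) :
    (∃ l : List V, (G.startDiagram Y).IsTopologicalSort l) ∧
      ∀ l : List V, (G.startDiagram Y).IsTopologicalSort l →
        ∀ R : Finset V, R ∈ G.POISs Y l ↔ IsPOIS G Y R :=
  ⟨CausalDiagram.exists_isTopologicalSort _, fun _ hl _ =>
    (CausalDiagram.mem_POISs_iff hY hl).trans (CausalDiagram.isPOIS_iff hY).symm⟩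

theorem mainTheorem8 {V : Type u} [Fintype V] [DecidableEq V] (G : CausalDiagram V)
    (hV : G.verts = Finset.univ) (Y : V) :
    (∃ l : List V, (G.startDiagram Y).IsTopologicalSort l) ∧
      ∀ l : List V, (G.startDiagram Y).IsTopologicalSort l →
        ∀ R : Finset V, R ∈ G.POISs Y l ↔ IsPOIS G Y R :=
  mainTheorem8_general G Y (hV ▸ Finset.mem_univ Y)
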